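/- Let $\kappa,\delta,m>0$ and let $x_1,\dots,x_N:[0,\infty)\to\mathbb R^d$ be a solution of the density-induced consensus protocol $$\dot x_i=\kappa\sum_{k\in\mathcal N_i(t)}(x_k-x_i),\qquad i=1,\dots,N,$$ where $k\in\mathcal N_i(t)$ iff $x_k(t)\in B(x_i(t),\delta)$ and the open ball $B(x_i(t),\delta)$ contains more than $m$ of the points $x_1(t),\dots,x_N(t)$ (counted with multiplicity, $x_i(t)$ included). Since the right-hand side is discontinuous, "solution" means that the $x_i$ are continuous and satisfy the equation in integrated form, $x_i(t)=x_i(0)+\int_0^t\kappa\sum_{k\in\mathcal N_i(s)}(x_k(s)-x_i(s))\,ds$ for all $t\ge 0$. Subsets of $\{1,\dots,N\}$ are called clusters, and the agents form a digraph at each time, with an edge from $i$ to $j$ iff $i\in\mathcal N_j(t)$. A cluster is isolated if no edge in either direction joins it to an agent outside it, and connected if it is nonempty and its induced graph is (weakly) connected. A cluster $\mathcal A$ is $r$-densely packed at time $t$ if $\bigcup_{i\in\mathcal A}B(x_i(t),r/2)$ is connected and nonempty and each ball $B(x_i(t),r)$, $i\in\mathcal A$, contains more than $m$ agents. Write $H_{\mathcal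 A}(t)=\mathrm{conv}\big(\bigcup_{i\in\mathcal A}B(x_i(t),\delta/2)\big)$. Suppose that at some time $t_0\ge0$ the set $\{1,\dots,N\}$ is partitioned into $K$ isolated connected clusters $\mathcal A_1,\dots,\mathcal A_K$ such that $$H_{\mathcal A_k}(t_0)\cap H_{\mathcal A_l}(t_0)=\emptyset\qquad\text{for all }k\neq l. \tag{1}$$ If the closures of two of these open sets meet (that is, if (1) holds only with contact), suppose in addition that every $t\ge t_0$ has an $\varepsilon>0$ such that all neighbour sets $\mathcal N_i$ are constant on $[t,t+\varepsilon)$. Then, for all $t\ge t_0$, one has $H_{\mathcal A_k}(t)\cap H_{\mathcal A_l}(t)=\emptyset$ for all $k\ne l$, and all the clusters $\mathcal A_1,\dots,\mathcal A_K$ are isolated. Moreover, let $\mathcal A$ be one of the clusters $\mathcal A_k$ and suppose that $\mathcal A$ is $r$-densely packed at time $t_0$ for some $r\le\delta$ with $$\frac r\delta\,\mathcal Z^{r/\delta}\le\frac{m}{6\,\#\mathcal A}\,\mathcal Z,\qquad \mathcal Z:=e^{\frac{2m}{3(\#\mathcal A)^3}}.$$ Then $\mathcal A$ is $\delta$-densely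 packed at every time $t\ge t_0$, and for every $i\in\mathcal A$, $$x_i(t)\to x_{\mathcal A}:=\frac1{\#\mathcal A}\sum_{j\in\mathcal A}x_j(t_0)\qquad\text{as }t\to\infty.$$ -/

import Mathlib

open Set Filter Topology

namespace DI

noncomputable section

/-- Agents of the configuration `X` lying in the open ball of radius `ρ` about agent `i`
(agent `i` itself included when `ρ > 0`). -/
def near {d N : ℕ} (ρ : ℝ) (X : Fin N → EuclideanSpace ℝ (Fin d)) (i : Fin N) :
    Finset (Fin N) :=
  open scoped Classical in
  Finset.univ.filter fun k => X k ∈ Metric.ball (X i) ρ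

/-- The neighbour set of agent `i`: `k` belongs to it iff `X k ∈ B(X i, δ)` and
`B(X i, δ)` contains more than `m` agents. -/
def neighbors {d N : ℕ} (δ m : ℝ) (X : Fin N → EuclideanSpace ℝ (Fin d)) (i : Fin N) :
    Finset (Fin N) :=
  open scoped Classical in
  Finset.univ.filter fun k => k ∈ near δ X i ∧ m < ((near δ X i).card : ℝ)

/-- The right-hand side of the protocol, `κ ∑_{k ∈ N_i} (x_k - x_i)`. -/
def velocity {d N : ℕ} (κ δ m : ℝ) (X : Fin N → EuclideanSpace ℝ (Fin d)) (i : Fin N) :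
    EuclideanSpace ℝ (Fin d) :=
  κ • ∑ k ∈ neighbors δ m X i, (X k - X i)

/-- Solutions on `[0, ∞)` of `x_i' = κ ∑_{k ∈ N_i} (x_k - x_i)`. The right-hand side jumps when
the neighbour sets change, so the equation is imposed in integrated form: the trajectories are
continuous and satisfy the ODE for almost every time. (Along continuous trajectories the integrand
is measurable and locally bounded, so the integral is never a junk value.) -/
structure IsSolution {d N : ℕ} (κ δ m : ℝ)
    (x : ℝ → Fin N → EuclideanSpace ℝ (Fin d)) : Prop where
  continuousOn : ∀ i, ContinuousOn (fun t => x t i) (Ici 0)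
  integral_eq : ∀ i, ∀ t, 0 ≤ t → x t i = x 0 i + ∫ s in (0 : ℝ)..t, velocity κ δ m (x s) i

/-- The edges of the communication digraph: `E(i, j) = 1` iff `i ∈ N_j`. -/
def Edge {d N : ℕ} (δ m : ℝ) (X : Fin N → EuclideanSpace ℝ (Fin d)) (i j : Fin N) : Prop :=
  i ∈ neighbors δ m X j

/-- The cluster `A` is isolated: no edge joins it, in either direction, to a node outside. -/
def IsIsolated {d N : ℕ} (δ m : ℝ) (X : Fin N → EuclideanSpace ℝ (Fin d))
    (A : Finset (Fin N)) : Prop :=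
  ∀ i ∈ A, ∀ j ∉ A, ¬ Edge δ m X i j ∧ ¬ Edge δ m X j i

/-- The cluster `A` is (weakly) connected: the undirected graph underlying the communication
digraph restricted to `A` is connected; in particular `A` is nonempty. -/
def IsWeaklyConnected {d N : ℕ} (δ m : ℝ) (X : Fin N → EuclideanSpace ℝ (Fin d))
    (A : Finset (Fin N)) : Prop :=
  ((SimpleGraph.fromRel (Edge δ m X)).induce (A : Set (Fin N))).Connected

/-- The cluster `A` is `r`-densely packed in the configuration `X`. -/
def IsDenselyPacked {d N : ℕ} (m r : ℝ) (X : Fin N → EuclideanSpace ℝ (Fin d))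
    (A : Finset (Fin N)) : Prop :=
  IsConnected (⋃ i ∈ A, Metric.ball (X i) (r / 2)) ∧
    ∀ i ∈ A, m < ((near r X i).card : ℝ)

/-- The convex hull of the `δ/2`-neighbourhood of the cluster `A`. -/
def hull {d N : ℕ} (δ : ℝ) (X : Fin N → EuclideanSpace ℝ (Fin d)) (A : Finset (Fin N)) :
    Set (EuclideanSpace ℝ (Fin d)) :=
  convexHull ℝ (⋃ i ∈ A, Metric.ball (X i) (δ / 2))

/-- The centre of mass of the cluster `A`. -/
def centerOfMass {d N : ℕ} (X : Fin N → EuclideanSpace ℝ (Fin d)) (A : Finset (Fin N)) :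
    EuclideanSpace ℝ (Fin d) :=
  (A.card : ℝ)⁻¹ • ∑ i ∈ A, X i

/-- From time `t₀` on, the communication network has locally constant coefficients to the right:
each `t ≥ t₀` is the left end of an interval `[t, t + ε)` on which no neighbour set changes. -/
def NetworkRightConstant {d N : ℕ} (δ m : ℝ) (x : ℝ → Fin N → EuclideanSpace ℝ (Fin d))
    (t₀ : ℝ) : Prop :=
  ∀ t, t₀ ≤ t → ∃ ε > 0, ∀ s ∈ Ico t (t + ε), ∀ i,
    neighbors δ m (x s) i = neighbors δ m (x t) i

/-- The number `Z = exp (2m / (3 (#A)³))`. -/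
def Z {N : ℕ} (m : ℝ) (A : Finset (Fin N)) : ℝ :=
  Real.exp (2 * m / (3 * (A.card : ℝ) ^ 3))

end

end DI

namespace DI

/-! ### Static geometry: cluster hulls, separation and packing. -/

section Geometry

variable {d N : ℕ}

/-! While a cluster receives nothing from outside, its agents move towards one another, so the
convex hull of their positions cannot grow (`IsSolution.apply_le_of_apply_le`,
`IsSolution.mem_convexHull`). Conversely, while the agents stay in their initial convex hulls,
disjointness of the fattened hulls keeps different clusters at distance at least `δ`, so no edge
joins them. A continuous induction in time closes this loop
(`IsSolution.mem_convexHull_of_separated`). It needs separation just after each time: a strict gap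
and continuity give it if the closures are disjoint, right-constancy of the network if they touch.

For a densely packed cluster, disjoint `r`-balls with more than `m` agents each bound the diameter
(`IsDenselyPacked.dist_lt`), and smallness of `r` brings it below `δ`. Hull invariance preserves
this, so all members see exactly the cluster for ever. The equation becomes linear and is solved
explicitly: exponential convergence to the conserved mean (`IsSolution.tendsto_centerOfMass`). -/

theorem mem_near {ρ : ℝ} {X : Fin N → EuclideanSpace ℝ (Fin d)} {i k : Fin N} :
    k ∈ near ρ X i ↔ dist (X k) (X i) < ρ := by
  simp [near]

theorem mem_neighbors {δ m : ℝ} {X : Fin N → EuclideanSpace ℝ (Fin d)} {i k : Fin N} :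
    k ∈ neighbors δ m X i ↔ dist (X k) (X i) < δ ∧ m < ((near δ X i).card : ℝ) := by
  simp [neighbors, mem_near]

theorem ball_subset_hull {δ : ℝ} {X : Fin N → EuclideanSpace ℝ (Fin d)} {A : Finset (Fin N)}
    {i : Fin N} (hi : i ∈ A) : Metric.ball (X i) (δ / 2) ⊆ hull δ X A :=
  (subset_biUnion_of_mem (u := fun i => Metric.ball (X i) (δ / 2)) hi).trans
    (subset_convexHull ℝ _)

/-- The offset `y - p` carries every centre into its own ball, hence by convexity it carries every
convex combination of centres into the hull. -/
theorem ball_subset_hull_of_mem_convexHull {δ : ℝ} {X : Fin N → EuclideanSpace ℝ (Fin d)}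
    {A : Finset (Fin N)} {p : EuclideanSpace ℝ (Fin d)}
    (hp : p ∈ convexHull ℝ (X '' (A : Set (Fin N)))) :
    Metric.ball p (δ / 2) ⊆ hull δ X A := by
  intro y hy
  have hconv : Convex ℝ ((fun q => (y - p) + q) ⁻¹' hull δ X A) :=
    (convex_convexHull ℝ _).translate_preimage_right _
  have hsub : X '' (A : Set (Fin N)) ⊆ (fun q => (y - p) + q) ⁻¹' hull δ X A := by
    rintro _ ⟨i, hi, rfl⟩
    refine ball_subset_hull hi ?_
    simpa [dist_eq_norm] using hy
  simpa using convexHull_min hsub hconv hp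

theorem hull_subset_hull {δ : ℝ} {X Y : Fin N → EuclideanSpace ℝ (Fin d)} {A : Finset (Fin N)}
    (h : ∀ i ∈ A, Y i ∈ convexHull ℝ (X '' (A : Set (Fin N)))) : hull δ Y A ⊆ hull δ X A :=
  convexHull_min (iUnion₂_subset fun i hi => ball_subset_hull_of_mem_convexHull (h i hi))
    (convex_convexHull ℝ _)

theorem le_dist_of_disjoint_ball {p q : EuclideanSpace ℝ (Fin d)} {δ : ℝ}
    (h : Disjoint (Metric.ball p (δ / 2)) (Metric.ball q (δ / 2))) : δ ≤ dist p q := by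
  by_contra! hlt
  refine Set.disjoint_left.1 h (?_ : midpoint ℝ p q ∈ _) ?_
  · rw [Metric.mem_ball, dist_midpoint_left]
    norm_num; linarith
  · rw [Metric.mem_ball, dist_midpoint_right]
    norm_num; linarith

theorem lt_dist_of_disjoint_closedBall {p q : EuclideanSpace ℝ (Fin d)} {δ : ℝ}
    (h : Disjoint (Metric.closedBall p (δ / 2)) (Metric.closedBall q (δ / 2))) :
    δ < dist p q := by
  by_contra! hlt
  refine Set.disjoint_left.1 h (?_ : midpoint ℝ p q ∈ _) ?_
  · rw [Metric.mem_closedBall, dist_midpoint_left]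
    norm_num; linarith
  · rw [Metric.mem_closedBall, dist_midpoint_right]
    norm_num; linarith

theorem le_dist_of_disjoint_hull {δ : ℝ} {X : Fin N → EuclideanSpace ℝ (Fin d)}
    {A B : Finset (Fin N)} (h : Disjoint (hull δ X A) (hull δ X B)) {i j : Fin N}
    (hi : i ∈ A) (hj : j ∈ B) : δ ≤ dist (X i) (X j) :=
  le_dist_of_disjoint_ball (h.mono (ball_subset_hull hi) (ball_subset_hull hj))

/-- The strict inequality leaves room for a continuity argument in time. -/
theorem lt_dist_of_disjoint_closure_hull {δ : ℝ} (hδ : 0 < δ)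
    {X : Fin N → EuclideanSpace ℝ (Fin d)} {A B : Finset (Fin N)}
    (h : Disjoint (closure (hull δ X A)) (closure (hull δ X B)))
    {p q : EuclideanSpace ℝ (Fin d)} (hp : p ∈ convexHull ℝ (X '' (A : Set (Fin N))))
    (hq : q ∈ convexHull ℝ (X '' (B : Set (Fin N)))) : δ < dist p q := by
  have hδ' : δ / 2 ≠ 0 := by positivity
  refine lt_dist_of_disjoint_closedBall (h.mono ?_ ?_)
  · rw [← closure_ball _ hδ']
    exact closure_mono (ball_subset_hull_of_mem_convexHull hp)
  · rw [← closure_ball _ hδ']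
    exact closure_mono (ball_subset_hull_of_mem_convexHull hq)

theorem le_dist_of_notMem_cluster {K : ℕ} {δ : ℝ} {X : Fin N → EuclideanSpace ℝ (Fin d)}
    {A : Fin K → Finset (Fin N)} (hpart : ∀ i, ∃! k, i ∈ A k)
    (hdisj : ∀ k l, k ≠ l → Disjoint (hull δ X (A k)) (hull δ X (A l)))
    {k : Fin K} {i j : Fin N} (hi : i ∈ A k) (hj : j ∉ A k) : δ ≤ dist (X i) (X j) := by
  obtain ⟨l, hl, -⟩ := hpart j
  exact le_dist_of_disjoint_hull (hdisj k l (by rintro rfl; exact hj hl)) hi hl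

theorem isIsolated_of_le_dist {δ m : ℝ} {X : Fin N → EuclideanSpace ℝ (Fin d)}
    {A : Finset (Fin N)} (h : ∀ i ∈ A, ∀ j ∉ A, δ ≤ dist (X i) (X j)) : IsIsolated δ m X A := by
  intro i hi j hj
  have hij := h i hi j hj
  refine ⟨fun hE => (mem_neighbors.1 hE).1.not_ge hij, fun hE => ?_⟩
  rw [dist_comm] at hij
  exact (mem_neighbors.1 hE).1.not_ge hij

theorem isDenselyPacked_of_dist_lt {δ m : ℝ} (hδ : 0 < δ) {X : Fin N → EuclideanSpace ℝ (Fin d)}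
    {A : Finset (Fin N)} (hne : A.Nonempty) (hcard : m < (A.card : ℝ))
    (h : ∀ i ∈ A, ∀ j ∈ A, dist (X i) (X j) < δ) : IsDenselyPacked m δ X A := by
  constructor
  · refine IsConnected.biUnion_of_reflTransGen hne
      (fun i _ => (convex_ball _ _).isConnected ⟨X i, Metric.mem_ball_self (by positivity)⟩)
      fun i hi j hj => Relation.ReflTransGen.single ⟨?_, hi⟩
    by_contra hempty
    exact (h i hi j hj).not_ge (le_dist_of_disjoint_ball
      (Set.disjoint_iff_inter_eq_empty.2 (Set.not_nonempty_iff_eq_empty.1 hempty)))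
  · intro i hi
    refine hcard.trans_le (Nat.cast_le.2 (Finset.card_le_card fun j hj => ?_))
    exact mem_near.2 (h j hj i hi)

/-- Balls are convex; this is used once for each of the two points. -/
theorem dist_lt_of_mem_convexHull {X : Fin N → EuclideanSpace ℝ (Fin d)} {A : Finset (Fin N)}
    {δ : ℝ} (h : ∀ i ∈ A, ∀ j ∈ A, dist (X i) (X j) < δ) {p q : EuclideanSpace ℝ (Fin d)}
    (hp : p ∈ convexHull ℝ (X '' (A : Set (Fin N))))
    (hq : q ∈ convexHull ℝ (X '' (A : Set (Fin N)))) : dist p q < δ := by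
  have hball : ∀ i ∈ A, p ∈ Metric.ball (X i) δ := fun i hi =>
    convexHull_min (by rintro _ ⟨j, hj, rfl⟩; exact h j hj i hi) (convex_ball _ _) hp
  have : q ∈ Metric.ball p δ :=
    convexHull_min
      (by rintro _ ⟨j, hj, rfl⟩; rw [Metric.mem_ball, dist_comm]; exact hball j hj)
      (convex_ball _ _) hq
  rw [dist_comm]; exact this

/-- A connected cluster whose `r`-balls all contain more than `m` agents has diameter less than
`3 r #A / m`: the `r`-balls of agents at distance roughly `0, 3r, 6r, …` from a given agent are
disjoint. -/
theorem IsDenselyPacked.dist_lt {m r : ℝ} (hm : 0 < m) (hr : 0 < r)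
    {X : Fin N → EuclideanSpace ℝ (Fin d)} {A : Finset (Fin N)} (hA : IsDenselyPacked m r X A)
    (hsub : ∀ i ∈ A, near r X i ⊆ A) {u v : Fin N} (hu : u ∈ A) (hv : v ∈ A) :
    dist (X u) (X v) < 3 * r * A.card / m := by
  set J := ⌊dist (X u) (X v) / (3 * r)⌋₊ with hJ
  have hmem : ∀ i ∈ A, X i ∈ ⋃ i ∈ A, Metric.ball (X i) (r / 2) := fun i hi =>
    mem_biUnion hi (Metric.mem_ball_self (by positivity))
  have hexists : ∀ j ∈ Finset.range (J + 1),
      ∃ i ∈ A, |dist (X u) (X i) - 3 * r * j| < r / 2 := by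
    intro j hj
    have hle : 3 * r * j ≤ dist (X u) (X v) := by
      have h1 : (j : ℝ) ≤ J := by exact_mod_cast Nat.lt_succ_iff.1 (Finset.mem_range.1 hj)
      have h2 : (J : ℝ) ≤ dist (X u) (X v) / (3 * r) := Nat.floor_le (by positivity)
      have h3 := h1.trans h2
      rw [le_div_iff₀ (by positivity)] at h3
      linarith
    -- On the connected union of balls the distance to `X u` takes every intermediate value.
    obtain ⟨p, hp, hpj⟩ := hA.1.isPreconnected.intermediate_value (hmem u hu) (hmem v hv)
      (f := fun p => dist (X u) p) (by fun_prop)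
      (show 3 * r * j ∈ _ by simp only [dist_self]; exact ⟨by positivity, hle⟩)
    obtain ⟨i, hi, hpi⟩ := mem_iUnion₂.1 hp
    refine ⟨i, hi, ?_⟩
    rw [← hpj]
    refine lt_of_le_of_lt ?_ (Metric.mem_ball.1 hpi)
    have h := abs_dist_sub_le (X i) p (X u)
    rwa [dist_comm (X i) (X u), dist_comm p (X u), dist_comm (X i) p] at h
  have : Nonempty (Fin N) := ⟨u⟩
  choose! a haA ha using hexists
  have hdisj : ∀ j ∈ Finset.range (J + 1), ∀ l ∈ Finset.range (J + 1), j < l →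
      Disjoint (near r X (a j)) (near r X (a l)) := by
    intro j hj l hl hjl
    rw [Finset.disjoint_left]
    intro k hkj hkl
    rw [mem_near] at hkj hkl
    have h1 := abs_lt.1 (ha j hj)
    have h2 := abs_lt.1 (ha l hl)
    have h3 : (j : ℝ) + 1 ≤ l := by exact_mod_cast hjl
    have h4 := dist_triangle (X u) (X k) (X (a l))
    have h5 := dist_triangle_right (X u) (X k) (X (a j))
    have h6 : 3 * r * (j + 1) ≤ 3 * r * l := by gcongr
    -- A common agent would make the distances of the two centres from `X u` differ by less than `2
    -- * r + r`, but the spacing is at least `3 * r`.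
    linarith
  have hpair : ((Finset.range (J + 1) : Finset ℕ) : Set ℕ).PairwiseDisjoint
      (fun j => near r X (a j)) := by
    intro j hj l hl hjl
    rcases lt_or_gt_of_ne hjl with h | h
    · exact hdisj j hj l hl h
    · exact (hdisj l hl j hj h).symm
  have hcard : ∑ j ∈ Finset.range (J + 1), (near r X (a j)).card ≤ A.card := by
    rw [← Finset.card_biUnion hpair]
    exact Finset.card_le_card (Finset.biUnion_subset.2 fun j hj => hsub _ (haA j hj))
  have hlt : (J + 1 : ℝ) * m < A.card := by
    calc (J + 1 : ℝ) * m = ∑ _j ∈ Finset.range (J + 1), m := by simp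
      _ < ∑ j ∈ Finset.range (J + 1), ((near r X (a j)).card : ℝ) :=
        Finset.sum_lt_sum_of_nonempty (by simp) fun j hj => hA.2 _ (haA j hj)
      _ ≤ A.card := by exact_mod_cast hcard
  have hfl : dist (X u) (X v) / (3 * r) < J + 1 := Nat.lt_floor_add_one _
  rw [div_lt_iff₀ (by positivity)] at hfl
  rw [lt_div_iff₀ hm]
  calc dist (X u) (X v) * m < (J + 1) * (3 * r) * m := by gcongr
    _ = 3 * r * ((J + 1) * m) := by ring
    _ < 3 * r * A.card := by gcongr

/-- The exponent is at most `2 / 3`, just below `log 2`. -/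
theorem Z_lt_two {m : ℝ} {A : Finset (Fin N)} (hcard : m < (A.card : ℝ))
    (hne : A.Nonempty) : Z m A < 2 := by
  have h1 : (1 : ℝ) ≤ A.card := by exact_mod_cast hne.card_pos
  have h2 : 2 * m / (3 * (A.card : ℝ) ^ 3) ≤ 2 / 3 := by
    rw [div_le_div_iff₀ (by positivity) (by norm_num)]
    have : (A.card : ℝ) ≤ (A.card : ℝ) ^ 3 := le_self_pow₀ h1 (by norm_num)
    linarith
  rw [Z, ← Real.lt_log_iff_exp_lt (by norm_num)]
  linarith [Real.log_two_gt_d9]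

theorem one_le_Z {m : ℝ} (hm : 0 < m) (A : Finset (Fin N)) : 1 ≤ Z m A :=
  Real.one_le_exp (by positivity)

/-- Under the smallness condition on `r`, an `r`-densely packed cluster has diameter below `δ`. -/
theorem IsDenselyPacked.dist_lt_of_small {δ m r : ℝ} (hδ : 0 < δ) (hm : 0 < m)
    {X : Fin N → EuclideanSpace ℝ (Fin d)} {A : Finset (Fin N)} (hA : IsDenselyPacked m r X A)
    (hsub : ∀ i ∈ A, near r X i ⊆ A)
    (hsmall : r / δ * Z m A ^ (r / δ) ≤ m / (6 * (A.card : ℝ)) * Z m A)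
    {u v : Fin N} (hu : u ∈ A) (hv : v ∈ A) : dist (X u) (X v) < δ := by
  have hr : 0 < r := by
    obtain ⟨p, hp⟩ := hA.1.nonempty
    obtain ⟨i, -, hpi⟩ := mem_iUnion₂.1 hp
    linarith [Metric.pos_of_mem_ball hpi]
  have hcard : m < (A.card : ℝ) :=
    (hA.2 u hu).trans_le (Nat.cast_le.2 (Finset.card_le_card (hsub u hu)))
  have hn : (0 : ℝ) < A.card := hm.trans hcard
  have hrpow : 1 ≤ Z m A ^ (r / δ) := Real.one_le_rpow (one_le_Z hm A) (by positivity)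
  have h1 : r / δ ≤ r / δ * Z m A ^ (r / δ) := le_mul_of_one_le_right (by positivity) hrpow
  have h2 : m / (6 * (A.card : ℝ)) * Z m A < m / (6 * (A.card : ℝ)) * 2 := by
    gcongr
    exact Z_lt_two hcard ⟨u, hu⟩
  have h3 : r / δ < m / (6 * (A.card : ℝ)) * 2 := (h1.trans hsmall).trans_lt h2
  have h4 : r * (3 * A.card) < m * δ := by
    have h5 : m / (6 * (A.card : ℝ)) * 2 = m / (3 * A.card) := by field_simp; norm_num
    rwa [h5, div_lt_div_iff₀ hδ (by positivity)] at h3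
  refine (hA.dist_lt hm hr hsub hu hv).trans ?_
  rw [div_lt_iff₀ hm]
  linarith

end Geometry

/-! ### Dynamics: integrability, invariance of hulls, convergence. -/

section Dynamics

variable {d N : ℕ}

/-- A sum over a fixed index set makes measurability in `X` accessible. -/
theorem velocity_eq_sum_ite {κ δ m : ℝ} (X : Fin N → EuclideanSpace ℝ (Fin d)) (i : Fin N) :
    velocity κ δ m X i = κ • ∑ k, if k ∈ neighbors δ m X i then X k - X i else 0 := by
  simp [velocity]

theorem measurableSet_mem_neighbors (δ m : ℝ) (i k : Fin N) :
    MeasurableSet {X : Fin N → EuclideanSpace ℝ (Fin d) | k ∈ neighbors δ m X i} := by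
  classical
  have hdist : ∀ k, MeasurableSet
      {X : Fin N → EuclideanSpace ℝ (Fin d) | dist (X k) (X i) < δ} := fun k =>
    (isOpen_lt (by fun_prop) continuous_const).measurableSet
  have hcard : Measurable
      fun X : Fin N → EuclideanSpace ℝ (Fin d) => ((near δ X i).card : ℝ) := by
    have : (fun X : Fin N → EuclideanSpace ℝ (Fin d) => ((near δ X i).card : ℝ))
        = fun X => ∑ k, if dist (X k) (X i) < δ then (1 : ℝ) else 0 := by
      ext X
      simp [near]
    rw [this]
    exact Finset.measurable_fun_sum _ fun k _ =>
      Measurable.ite (hdist k) measurable_const measurable_const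
  simp only [mem_neighbors]
  exact (hdist k).inter (measurableSet_lt measurable_const hcard)

theorem measurable_velocity (κ δ m : ℝ) (i : Fin N) :
    Measurable fun X : Fin N → EuclideanSpace ℝ (Fin d) => velocity κ δ m X i := by
  classical
  simp only [velocity_eq_sum_ite]
  refine Measurable.const_smul (Finset.measurable_fun_sum _ fun k _ => ?_) κ
  exact Measurable.ite (measurableSet_mem_neighbors δ m i k) (by fun_prop) measurable_const

theorem norm_velocity_le {κ δ m : ℝ} (hκ : 0 < κ) (X : Fin N → EuclideanSpace ℝ (Fin d))
    (i : Fin N) : ‖velocity κ δ m X i‖ ≤ κ * ∑ k, ‖X k - X i‖ := by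
  rw [velocity, norm_smul, Real.norm_of_nonneg hκ.le]
  gcongr
  exact (norm_sum_le _ _).trans
    (Finset.sum_le_sum_of_subset_of_nonneg (Finset.subset_univ _) fun _ _ _ => norm_nonneg _)

variable {κ δ m : ℝ} {x : ℝ → Fin N → EuclideanSpace ℝ (Fin d)}

theorem IsSolution.intervalIntegrable (hκ : 0 < κ) (hx : IsSolution κ δ m x) (i : Fin N)
    {a b : ℝ} (ha : 0 ≤ a) (hb : 0 ≤ b) :
    IntervalIntegrable (fun s => velocity κ δ m (x s) i) MeasureTheory.volume a b := by
  have hsub : uIcc a b ⊆ Ici 0 := fun s hs => (le_min ha hb).trans hs.1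
  have hcont : ∀ k, ContinuousOn (fun s => x s k) (uIcc a b) := fun k =>
    (hx.continuousOn k).mono hsub
  have hx' : AEMeasurable x (MeasureTheory.volume.restrict (uIoc a b)) :=
    aemeasurable_pi_lambda _ fun k =>
      ((hcont k).mono uIoc_subset_uIcc).aemeasurable measurableSet_uIoc
  have hbound : IntervalIntegrable (fun s => κ * ∑ k, ‖x s k - x s i‖)
      MeasureTheory.volume a b :=
    ContinuousOn.intervalIntegrable (continuousOn_const.mul
      (continuousOn_finsetSum _ fun k _ => ((hcont k).sub (hcont i)).norm))
  refine hbound.mono_fun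
    ((measurable_velocity κ δ m i).comp_aemeasurable hx').aestronglyMeasurable ?_
  refine Eventually.of_forall fun s => (norm_velocity_le hκ _ i).trans ?_
  exact le_abs_self _

theorem IsSolution.sub_eq_integral (hκ : 0 < κ) (hx : IsSolution κ δ m x) (i : Fin N)
    {a b : ℝ} (ha : 0 ≤ a) (hb : 0 ≤ b) :
    x b i - x a i = ∫ s in a..b, velocity κ δ m (x s) i := by
  rw [hx.integral_eq i a ha, hx.integral_eq i b hb, add_sub_add_left_eq_sub,
    intervalIntegral.integral_interval_sub_left
      (hx.intervalIntegrable hκ i le_rfl hb) (hx.intervalIntegrable hκ i le_rfl ha)]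

theorem IsSolution.tendsto_right (hx : IsSolution κ δ m x) (i : Fin N) {t : ℝ} (ht : 0 ≤ t) :
    Tendsto (fun s => x s i) (𝓝[>] t) (𝓝 (x t i)) :=
  ((hx.continuousOn i) t ht).mono_left
    (nhdsWithin_mono t fun _ hs => ht.trans (le_of_lt hs))

/-- Maximum principle: a half space containing a cluster keeps containing it as long as the
cluster receives nothing from outside. -/
theorem IsSolution.apply_le_of_apply_le (hκ : 0 < κ) (hx : IsSolution κ δ m x)
    {A : Finset (Fin N)} {a b : ℝ} (ha : 0 ≤ a) (hab : a ≤ b)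
    (hA : ∀ s ∈ Ico a b, ∀ i ∈ A, neighbors δ m (x s) i ⊆ A)
    (f : EuclideanSpace ℝ (Fin d) →L[ℝ] ℝ) {c : ℝ} (hc : ∀ i ∈ A, f (x a i) ≤ c) :
    ∀ i ∈ A, f (x b i) ≤ c := by
  -- A barrier of slope `η` provides the slack that the discontinuous velocity requires; `η` tends
  -- to zero at the end.
  have hbarrier : ∀ η > 0, ∀ i ∈ A, f (x b i) ≤ c + η * (b - a) := by
    intro η hη
    let S : Set ℝ := {t | ∀ i ∈ A, f (x t i) ≤ c + η * (t - a)}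
    have hclosed : IsClosed (S ∩ Icc a b) := by
      have hS : S ∩ Icc a b =
          Icc a b ∩ ⋂ i ∈ A, {t ∈ Icc a b | f (x t i) ≤ c + η * (t - a)} := by
        ext t
        simp only [S, mem_inter_iff, mem_ofPred_eq, mem_iInter]
        exact ⟨fun h => ⟨h.2, fun i hi => ⟨h.2, h.1 i hi⟩⟩, fun h => ⟨fun i hi => (h.2 i hi).2, h.1⟩⟩
      rw [hS]
      refine isClosed_Icc.inter (isClosed_biInter fun i _ =>
        isClosed_Icc.isClosed_le (f.continuous.comp_continuousOn ?_) (by fun_prop))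
      exact (hx.continuousOn i).mono fun t ht => ha.trans ht.1
    have hsub : Icc a b ⊆ S := by
      refine hclosed.Icc_subset_of_forall_mem_nhdsWithin (by simpa [S] using hc) ?_
      rintro t ⟨htS, htab⟩
      have ht0 : 0 ≤ t := ha.trans htab.1
      have hev : ∀ i ∈ A, ∀ᶠ s in 𝓝[>] t, f (x s i) ≤ c + η * (s - a) := by
        intro i hi
        have hlim : ∀ k, Tendsto (fun s => f (x s k)) (𝓝[>] t) (𝓝 (f (x t k))) := fun k =>
          (f.continuous.tendsto _).comp (hx.tendsto_right k ht0)
        have hlin : Tendsto (fun s => c + η * (s - a)) (𝓝[>] t) (𝓝 (c + η * (t - a))) :=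
          (Continuous.tendsto (by fun_prop) t).mono_left nhdsWithin_le_nhds
        rcases (htS i hi).lt_or_eq with hlt | heq
        · exact ((hlim i).eventually_lt hlin hlt).mono fun s hs => hs.le
        -- When agent `i` touches the barrier no other member exceeds it, so shortly afterwards all
        -- differences are below `ε`. With at most `N` neighbours, this bounds the speed by `η`.
        set ε := η / (κ * (N + 1)) with hε
        have hεpos : 0 < ε := by positivity
        have hdiff : ∀ᶠ s in 𝓝[>] t, ∀ k ∈ A, f (x s k) - f (x s i) < ε := by
          refine (Filter.eventually_all_finset A).2 fun k hk => ?_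
          refine ((hlim k).sub (hlim i)).eventually_lt_const ?_
          have := htS k hk
          linarith
        obtain ⟨e, hte, he⟩ := (mem_nhdsGT_iff_exists_Ioo_subset).1
          (hdiff.and (Ioo_mem_nhdsGT htab.2))
        filter_upwards [Ioo_mem_nhdsGT hte] with s hs
        have hs0 : 0 ≤ s := ht0.trans hs.1.le
        have hint := congrArg f (hx.sub_eq_integral hκ i ht0 hs0)
        have hii := hx.intervalIntegrable hκ i ht0 hs0
        rw [← ContinuousLinearMap.intervalIntegral_comp_comm f hii, map_sub] at hint
        have hfii : IntervalIntegrable (fun σ => f (velocity κ δ m (x σ) i))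
            MeasureTheory.volume t s := ⟨f.integrable_comp hii.1, f.integrable_comp hii.2⟩
        have hle : ∫ σ in t..s, f (velocity κ δ m (x σ) i) ≤ ∫ _σ in t..s, η := by
          refine intervalIntegral.integral_mono_on_of_le_Ioo hs.1.le hfii
            intervalIntegrable_const fun σ hσ => ?_
          obtain ⟨h1, h2⟩ := he ⟨hσ.1, hσ.2.trans hs.2⟩
          have hnb := hA σ ⟨htab.1.trans hσ.1.le, h2.2⟩ i hi
          rw [velocity, map_smul, map_sum, smul_eq_mul]
          have hsum : ∑ k ∈ neighbors δ m (x σ) i, f (x σ k - x σ i) ≤ (N + 1) * ε := by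
            calc ∑ k ∈ neighbors δ m (x σ) i, f (x σ k - x σ i)
                ≤ ∑ _k ∈ neighbors δ m (x σ) i, ε :=
                  Finset.sum_le_sum fun k hk => by
                    rw [map_sub]; exact (h1 k (hnb hk)).le
              _ = (neighbors δ m (x σ) i).card * ε := by simp
              _ ≤ (N + 1) * ε := by
                gcongr
                have : (neighbors δ m (x σ) i).card ≤ N := by
                  simpa using Finset.card_le_univ (neighbors δ m (x σ) i)
                have h : ((neighbors δ m (x σ) i).card : ℝ) ≤ N := by exact_mod_cast this
                linarith
          calc κ * ∑ k ∈ neighbors δ m (x σ) i, f (x σ k - x σ i) ≤ κ * ((N + 1) * ε) := by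
                gcongr
            _ = η := by rw [hε]; field_simp
        rw [intervalIntegral.integral_const, smul_eq_mul] at hle
        linarith
      exact (Filter.eventually_all_finset A).2 hev
    exact hsub ⟨hab, le_rfl⟩
  intro i hi
  refine le_of_forall_pos_le_add fun ε hε => ?_
  have h := hbarrier (ε / (b - a + 1)) (by have := sub_nonneg.2 hab; positivity) i hi
  have : ε / (b - a + 1) * (b - a) ≤ ε := by
    rw [div_mul_eq_mul_div, div_le_iff₀ (by linarith)]
    nlinarith
  linarith

/-- Hahn–Banach reduces a closed convex set to half spaces. -/
theorem IsSolution.mem_convexHull (hκ : 0 < κ) (hx : IsSolution κ δ m x)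
    {A : Finset (Fin N)} {C : Set (EuclideanSpace ℝ (Fin d))} (hC : IsClosed C)
    (hCc : Convex ℝ C) {a b : ℝ} (ha : 0 ≤ a) (hab : a ≤ b)
    (hA : ∀ s ∈ Ico a b, ∀ i ∈ A, neighbors δ m (x s) i ⊆ A) (h : ∀ i ∈ A, x a i ∈ C) :
    ∀ i ∈ A, x b i ∈ C := by
  intro i hi
  by_contra hmem
  obtain ⟨f, u, hf, hu⟩ := geometric_hahn_banach_closed_point hCc hC hmem
  exact (hx.apply_le_of_apply_le hκ ha hab hA f (fun j hj => (hf _ (h j hj)).le) i hi).not_gt hu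

/-- Convex hulls of clusters are forward invariant, provided that whenever no agent has left the
initial hull of its cluster, the clusters do not interact for a short time. -/
theorem IsSolution.mem_convexHull_of_separated (hκ : 0 < κ) (hx : IsSolution κ δ m x) {t₀ : ℝ}
    (ht₀ : 0 ≤ t₀) {K : ℕ} {A : Fin K → Finset (Fin N)}
    (hsep : ∀ t, t₀ ≤ t →
      (∀ k, ∀ i ∈ A k, x t i ∈ convexHull ℝ (x t₀ '' (A k : Set (Fin N)))) →
      ∀ᶠ s in 𝓝[≥] t, ∀ k, ∀ i ∈ A k, neighbors δ m (x s) i ⊆ A k)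
    {t : ℝ} (ht : t₀ ≤ t) :
    ∀ k, ∀ i ∈ A k, x t i ∈ convexHull ℝ (x t₀ '' (A k : Set (Fin N))) := by
  have hclosedHull : ∀ k, IsClosed (convexHull ℝ (x t₀ '' (A k : Set (Fin N)))) := fun k =>
    (((A k).finite_toSet.image _).isCompact_convexHull ℝ).isClosed
  let S : Set ℝ := {t | ∀ k, ∀ i ∈ A k, x t i ∈ convexHull ℝ (x t₀ '' (A k : Set (Fin N)))}
  have hclosed : IsClosed (S ∩ Icc t₀ t) := by
    have hS : S ∩ Icc t₀ t = Icc t₀ t ∩ ⋂ k, ⋂ i ∈ A k,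
        (Icc t₀ t ∩ (fun s => x s i) ⁻¹' convexHull ℝ (x t₀ '' (A k : Set (Fin N)))) := by
      ext s
      simp only [S, mem_inter_iff, mem_ofPred_eq, mem_iInter, mem_preimage]
      exact ⟨fun h => ⟨h.2, fun k i hi => ⟨h.2, h.1 k i hi⟩⟩,
        fun h => ⟨fun k i hi => (h.2 k i hi).2, h.1⟩⟩
    rw [hS]
    refine isClosed_Icc.inter (isClosed_iInter fun k => isClosed_biInter fun i _ =>
      ContinuousOn.preimage_isClosed_of_isClosed ?_ isClosed_Icc (hclosedHull k))
    exact (hx.continuousOn i).mono fun s hs => ht₀.trans hs.1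
  have hsub : Icc t₀ t ⊆ S := by
    refine hclosed.Icc_subset_of_forall_mem_nhdsWithin
      (fun k i hi => subset_convexHull ℝ _ (mem_image_of_mem _ hi)) ?_
    rintro a ⟨haS, hat⟩
    obtain ⟨e, hae, he⟩ := mem_nhdsGE_iff_exists_Ico_subset.1 (hsep a hat.1 haS)
    filter_upwards [Ioo_mem_nhdsGT hae] with b hb k
    exact hx.mem_convexHull hκ (hclosedHull k) (convex_convexHull ℝ _) (ht₀.trans hat.1) hb.1.le
      (fun s hs i hi => he ⟨hs.1, hs.2.trans hb.2⟩ k i hi) (haS k)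
  exact hsub ⟨ht, le_rfl⟩

/-- Clusters with disjoint hulls stay inside their initial convex hulls. -/
theorem IsSolution.mem_convexHull_of_disjoint_hull (hκ : 0 < κ) (hδ : 0 < δ)
    (hx : IsSolution κ δ m x) {t₀ : ℝ} (ht₀ : 0 ≤ t₀) {K : ℕ} {A : Fin K → Finset (Fin N)}
    (hpart : ∀ i, ∃! k, i ∈ A k)
    (hdisj : ∀ k l, k ≠ l → Disjoint (hull δ (x t₀) (A k)) (hull δ (x t₀) (A l)))
    (htouch : (∃ k l, k ≠ l ∧
        ¬ Disjoint (closure (hull δ (x t₀) (A k))) (closure (hull δ (x t₀) (A l)))) →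
      NetworkRightConstant δ m x t₀) {t : ℝ} (ht : t₀ ≤ t) :
    ∀ k, ∀ i ∈ A k, x t i ∈ convexHull ℝ (x t₀ '' (A k : Set (Fin N))) := by
  refine hx.mem_convexHull_of_separated hκ ht₀ (fun s hs hinv => ?_) ht
  by_cases h : ∃ k l, k ≠ l ∧
      ¬ Disjoint (closure (hull δ (x t₀) (A k))) (closure (hull δ (x t₀) (A l)))
  · obtain ⟨ε, hε, hconst⟩ := htouch h s hs
    filter_upwards [Ico_mem_nhdsGE (lt_add_of_pos_right s hε)] with σ hσ k i hi j hj
    -- The neighbour sets at `σ` are those at `s`, where the weak bound `δ ≤ dist` already excludes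
    -- edges between clusters.
    rw [hconst σ hσ i] at hj
    by_contra hjA
    have hle := le_dist_of_notMem_cluster (X := x s) hpart
      (fun k l hkl => (hdisj k l hkl).mono (hull_subset_hull (hinv k)) (hull_subset_hull (hinv l)))
      hi hjA
    rw [dist_comm] at hle
    exact (mem_neighbors.1 hj).1.not_ge hle
  · push Not at h
    have hs0 : 0 ≤ s := ht₀.trans hs
    have hlim : ∀ i, Tendsto (fun σ => x σ i) (𝓝[≥] s) (𝓝 (x s i)) := fun i =>
      (hx.continuousOn i s hs0).mono_left (nhdsWithin_mono s fun _ hσ => hs0.trans hσ)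
    have hev : ∀ k i j, ∀ᶠ σ in 𝓝[≥] s, i ∈ A k → j ∉ A k → δ < dist (x σ j) (x σ i) := by
      intro k i j
      by_cases hij : i ∈ A k ∧ j ∉ A k
      · obtain ⟨l, hl, -⟩ := hpart j
        have hlk : l ≠ k := by rintro rfl; exact hij.2 hl
        have hlt := lt_dist_of_disjoint_closure_hull hδ (h l k hlk) (hinv l j hl) (hinv k i hij.1)
        exact (((hlim j).dist (hlim i)).eventually_const_lt hlt).mono fun _ hσ _ _ => hσ
      · exact Eventually.of_forall fun σ hi hj => (hij ⟨hi, hj⟩).elim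
    filter_upwards [eventually_all.2 fun k => eventually_all.2 fun i => eventually_all.2 (hev k i)]
      with σ hσ k i hi j hj
    by_contra hjA
    exact lt_asymm (mem_neighbors.1 hj).1 (hσ k i j hi hjA)

/-- If from time `t₀` on the neighbours of each agent of a cluster are exactly the members of the
cluster, then the cluster converges to its centre of mass. -/
theorem IsSolution.tendsto_centerOfMass (hκ : 0 < κ) (hx : IsSolution κ δ m x) {t₀ : ℝ}
    (ht₀ : 0 ≤ t₀) {A : Finset (Fin N)}
    (hA : ∀ t, t₀ ≤ t → ∀ i ∈ A, neighbors δ m (x t) i = A) {i : Fin N} (hi : i ∈ A) :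
    Tendsto (fun t => x t i) atTop (𝓝 (centerOfMass (x t₀) A)) := by
  have hn : (0 : ℝ) < A.card := by exact_mod_cast Finset.card_pos.2 ⟨i, hi⟩
  have hvel : ∀ t, t₀ ≤ t → ∀ j ∈ A, velocity κ δ m (x t) j =
      κ • (∑ k ∈ A, x t k - (A.card : ℝ) • x t j) := by
    intro t ht j hj
    rw [velocity, hA t ht j hj, Finset.sum_sub_distrib, Finset.sum_const, Nat.cast_smul_eq_nsmul]
  -- All-to-all coupling is symmetric, so the velocities sum to zero.
  have hsum : ∀ t, t₀ ≤ t → ∑ k ∈ A, x t k = ∑ k ∈ A, x t₀ k := by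
    intro t ht
    have ht0 : 0 ≤ t := ht₀.trans ht
    rw [← sub_eq_zero, ← Finset.sum_sub_distrib,
      Finset.sum_congr rfl fun k _ => hx.sub_eq_integral hκ k ht₀ ht0,
      ← intervalIntegral.integral_finsetSum fun k _ => hx.intervalIntegrable hκ k ht₀ ht0]
    refine (intervalIntegral.integral_congr (g := fun _ => 0) fun s hs => ?_).trans (by simp)
    rw [uIcc_of_le ht] at hs
    simp only
    rw [Finset.sum_congr rfl (hvel s hs.1), ← Finset.smul_sum, Finset.sum_sub_distrib,
      ← Finset.smul_sum, Finset.sum_const, Nat.cast_smul_eq_nsmul, sub_self, smul_zero]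
  set c := centerOfMass (x t₀) A with hc
  have hvel' : ∀ t, t₀ ≤ t → velocity κ δ m (x t) i = (κ * A.card) • (c - x t i) := by
    intro t ht
    rw [hvel t ht i hi, hsum t ht, hc, centerOfMass, mul_smul, smul_sub (A.card : ℝ),
      smul_inv_smul₀ hn.ne']
  have hcont : ContinuousOn (fun t => x t i) (Ici t₀) :=
    (hx.continuousOn i).mono (Ici_subset_Ici.2 ht₀)
  -- From `t₀` on the integrand agrees with a continuous function, so the integrated equation can be
  -- differentiated from the right.
  have hderiv : ∀ t, t₀ ≤ t →
      HasDerivWithinAt (fun s => x s i) ((κ * A.card : ℝ) • (c - x t i)) (Ici t) t := by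
    intro t ht
    have hc' : ContinuousOn (fun s => (κ * A.card : ℝ) • (c - x s i)) (Ici t₀) :=
      by fun_prop
    have hint : HasDerivWithinAt (fun u => ∫ s in t..u, (κ * A.card : ℝ) • (c - x s i))
        ((κ * A.card : ℝ) • (c - x t i)) (Ici t) t :=
      intervalIntegral.integral_hasDerivWithinAt_right (t := Ioi t) IntervalIntegrable.refl
        ((hc'.mono fun s hs => ht.trans (le_of_lt hs)).stronglyMeasurableAtFilter_nhdsWithin
          measurableSet_Ioi t)
        ((hc' t ht).mono fun s hs => ht.trans (le_of_lt hs))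
    refine (hint.const_add (x t i)).congr (fun u hu => ?_) (by simp)
    have h := hx.sub_eq_integral hκ i (ht₀.trans ht) (ht₀.trans (ht.trans hu))
    rw [← sub_eq_iff_eq_add', h]
    refine intervalIntegral.integral_congr fun s hs => ?_
    rw [uIcc_of_le hu] at hs
    exact hvel' s (ht.trans hs.1)
  have hexp : ∀ t, t₀ ≤ t →
      x t i = c + Real.exp (-(κ * A.card * (t - t₀))) • (x t₀ i - c) := by
    intro t ht
    have hE : ∀ s, HasDerivAt (fun s => Real.exp (κ * A.card * (s - t₀)))
        (Real.exp (κ * A.card * (s - t₀)) * (κ * A.card)) s := fun s => by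
      simpa using (((hasDerivAt_id s).sub_const t₀).const_mul (κ * A.card : ℝ)).exp
    -- The exponential is the integrating factor of the linear equation.
    have hconst := constant_of_has_deriv_right_zero
      (f := fun s => Real.exp (κ * A.card * (s - t₀)) • (x s i - c)) (a := t₀) (b := t)
      ((HasDerivAt.continuousOn fun s _ => hE s).smul
        ((hcont.mono Icc_subset_Ici_self).sub continuousOn_const))
      (fun s hs => by
        refine ((hE s).hasDerivWithinAt.smul ((hderiv s hs.1).sub_const c)).congr_deriv ?_
        rw [smul_smul, ← neg_sub (x s i) c, smul_neg, neg_add_cancel]) t ⟨ht, le_rfl⟩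
    simp only [sub_self, mul_zero, Real.exp_zero, one_smul] at hconst
    rw [← hconst, smul_smul, ← Real.exp_add, neg_add_cancel, Real.exp_zero, one_smul,
      add_sub_cancel]
  have hlim : Tendsto (fun t => c + Real.exp (-(κ * A.card * (t - t₀))) • (x t₀ i - c)) atTop
      (𝓝 c) := by
    have h1 : Tendsto (fun t : ℝ => κ * A.card * (t - t₀)) atTop atTop :=
      (tendsto_atTop_add_const_right _ (-t₀) tendsto_id).const_mul_atTop (by positivity)
    have h2 := ((Real.tendsto_exp_neg_atTop_nhds_zero.comp h1).smul_const
      (x t₀ i - c)).const_add c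
    simpa using h2
  exact hlim.congr' ((eventually_ge_atTop t₀).mono fun t ht => (hexp t ht).symm)

end Dynamics

end DI

theorem theorem1 {d N K : ℕ} (κ δ m : ℝ) (hκ : 0 < κ) (hδ : 0 < δ) (hm : 0 < m)
    (x : ℝ → Fin N → EuclideanSpace ℝ (Fin d)) (hx : DI.IsSolution κ δ m x)
    (t₀ : ℝ) (ht₀ : 0 ≤ t₀)
    (A : Fin K → Finset (Fin N)) (hpart : ∀ i, ∃! k, i ∈ A k)
    (hiso : ∀ k, DI.IsIsolated δ m (x t₀) (A k))
    (hconn : ∀ k, DI.IsWeaklyConnected δ m (x t₀) (A k))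
    (hdisj : ∀ k l, k ≠ l → Disjoint (DI.hull δ (x t₀) (A k)) (DI.hull δ (x t₀) (A l)))
    -- only if two of the (open) hulls touch each other at time `t₀`:
    (htouch : (∃ k l, k ≠ l ∧
        ¬ Disjoint (closure (DI.hull δ (x t₀) (A k))) (closure (DI.hull δ (x t₀) (A l)))) →
      DI.NetworkRightConstant δ m x t₀) :
    (∀ t, t₀ ≤ t →
      (∀ k l, k ≠ l → Disjoint (DI.hull δ (x t) (A k)) (DI.hull δ (x t) (A l))) ∧
      (∀ k, DI.IsIsolated δ m (x t) (A k))) ∧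
    (∀ k, ∀ r : ℝ, r ≤ δ → DI.IsDenselyPacked m r (x t₀) (A k) →
      r / δ * DI.Z m (A k) ^ (r / δ) ≤ m / (6 * ((A k).card : ℝ)) * DI.Z m (A k) →
      (∀ t, t₀ ≤ t → DI.IsDenselyPacked m δ (x t) (A k)) ∧
      (∀ i ∈ A k, Tendsto (fun t => x t i) atTop (𝓝 (DI.centerOfMass (x t₀) (A k))))) := by
  have hmem : ∀ t, t₀ ≤ t →
      ∀ k, ∀ i ∈ A k, x t i ∈ convexHull ℝ (x t₀ '' (A k : Set (Fin N))) := fun t ht =>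
    hx.mem_convexHull_of_disjoint_hull hκ hδ ht₀ hpart hdisj htouch ht
  have hdisj' : ∀ t, t₀ ≤ t →
      ∀ k l, k ≠ l → Disjoint (DI.hull δ (x t) (A k)) (DI.hull δ (x t) (A l)) :=
    fun t ht k l hkl => (hdisj k l hkl).mono (DI.hull_subset_hull (hmem t ht k))
      (DI.hull_subset_hull (hmem t ht l))
  have hdist : ∀ t, t₀ ≤ t → ∀ k, ∀ i ∈ A k, ∀ j ∉ A k, δ ≤ dist (x t i) (x t j) :=
    fun t ht k i hi j hj => DI.le_dist_of_notMem_cluster hpart (hdisj' t ht) hi hj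
  refine ⟨fun t ht => ⟨hdisj' t ht, fun k => DI.isIsolated_of_le_dist (hdist t ht k)⟩,
    fun k r hr hpack hsmall => ?_⟩
  have hnear : ∀ ρ ≤ δ, ∀ t, t₀ ≤ t → ∀ i ∈ A k, DI.near ρ (x t) i ⊆ A k := by
    intro ρ hρ t ht i hi j hj
    by_contra hjA
    have h := hdist t ht k i hi j hjA
    rw [dist_comm] at h
    exact (DI.mem_near.1 hj).not_ge (hρ.trans h)
  have hdiam : ∀ i ∈ A k, ∀ j ∈ A k, dist (x t₀ i) (x t₀ j) < δ := fun i hi j hj =>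
    hpack.dist_lt_of_small hδ hm (hnear r hr t₀ le_rfl) hsmall hi hj
  have hdiam' : ∀ t, t₀ ≤ t → ∀ i ∈ A k, ∀ j ∈ A k, dist (x t i) (x t j) < δ :=
    fun t ht i hi j hj =>
      DI.dist_lt_of_mem_convexHull hdiam (hmem t ht k i hi) (hmem t ht k j hj)
  have hcard : ∀ i ∈ A k, m < ((A k).card : ℝ) := fun i hi =>
    (hpack.2 i hi).trans_le
      (Nat.cast_le.2 (Finset.card_le_card (hnear r hr t₀ le_rfl i hi)))
  obtain ⟨⟨i₀, hi₀⟩⟩ := (hconn k).nonempty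
  refine ⟨fun t ht => DI.isDenselyPacked_of_dist_lt hδ ⟨i₀, hi₀⟩ (hcard i₀ hi₀) (hdiam' t ht),
    fun i hi => hx.tendsto_centerOfMass hκ ht₀ (fun t ht j hj => ?_) hi⟩
  -- Separation from other clusters gives one inclusion, diameter below `δ` the other.
  have hnearA : DI.near δ (x t) j = A k :=
    (hnear δ le_rfl t ht j hj).antisymm fun l hl => DI.mem_near.2 (hdiam' t ht l hl j hj)
  ext l
  rw [DI.mem_neighbors, ← DI.mem_near, hnearA]
  exact and_iff_left (hcard j hj)
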